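/- **Setting.** Let $\mathcal Y\subseteq\mathbb R^I$, $c\in\mathbb R^I$, $Q\in\mathbb R^{J\times N}$, $q\in\mathbb R^J$, $W\in\mathbb R^{S\times J}$, let $T(y)\in\mathbb R^{S\times N}$ and $R(y)\in\mathbb R^S$ be affine in $y$, and let $$h(y,\xi)=\min_{x\in\mathbb R^J}\{(Q\xi+q)^{\mathsf T}x:\ T(y)\xi+Wx\ge R(y)\}.$$ Let $\Xi_1,\dots,\Xi_L\subseteq\mathbb R^N$ be compact and $f=(f_1,\dots,f_M):\mathbb R^N\to\mathbb R^M$ continuous on each $\Xi_l$. Assume that for all $y\in\mathcal Y$ and $\xi\in\bigcup_l\Xi_l$ the second-stage problem defining $h(y,\xi)$ is feasible with finite value. Let $\rho\ge 0$, and for each $y\in\mathcal Y$ let $\hat p(y)\in\mathbb R^L_+$ with $\sum_l\hat p_l(y)=1$ and $\underline u_l(y),\bar u_l(y)\in\mathbb R^M$ be given (arbitrary functions of $y$). Put $$\Delta(\hat p(y))=\Big\{p\in\mathbb R^L_+:\ \sum_l p_l=1,\ \sum_l|p_l-\hat p_l(y)|\le\rho\Big\},$$ $$\mathcal U_l(y)=\Big\{\mathbb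 P_l\in\mathcal P(\Xi_l):\ \underline u_l(y)\le\int_{\Xi_l}f\,d\mathbb P_l\le\bar u_l(y)\Big\},$$ $$\Theta(y)=\Big\{\sum_l p_l\mathbb P_l:\ p\in\Delta(\hat p(y)),\ \mathbb P_l\in\mathcal U_l(y)\ \forall l\Big\},$$ where $\mathcal P(\Xi_l)$ is the set of Borel probability measures carried by $\Xi_l$. **Theorem.** Suppose that $\mathcal U_l(y)\neq\emptyset$ for every $y\in\mathcal Y$ and every $l$ (in particular, this holds if $\mathcal U_l(y)$ has a nonempty relative interior). Then the model $$\inf_{y\in\mathcal Y}\Big\{c^{\mathsf T}y+\max_{\mathbb P\in\Theta(y)}\mathbb E_{\xi\sim\mathbb P}[h(y,\xi)]\Big\}\tag{A}$$ is equivalent to the semi-infinite program $$\begin{aligned}\inf_{y,\lambda,\eta,r,\alpha,\underline\beta,\bar\beta}\quad& c^{\mathsf T}y+\eta+\rho\lambda+\sum_{l=1}^L\hat p_l(y)r_l\\ \text{s.t.}\quad& y\in\mathcal Y,\ \lambda\ge0,\ \underline\beta_l\ge0,\ \bar\beta_l\ge0,\\ &\alpha_l+\bar\beta_l^{\mathsf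 T}\bar u_l(y)-\underline\beta_l^{\mathsf T}\underline u_l(y)-\eta\le r_l,\\ &\alpha_l+\bar\beta_l^{\mathsf T}\bar u_l(y)-\underline\beta_l^{\mathsf T}\underline u_l(y)-\eta\le\lambda,\\ &r_l\ge-\lambda,\\ &\alpha_l+(\bar\beta_l-\underline\beta_l)^{\mathsf T}f(\xi)\ge h(y,\xi)\quad\forall\,\xi\in\Xi_l,\end{aligned}\tag{B}$$ with all constraints imposed for $l=1,\dots,L$, in the following sense. 1. For every $y\in\mathcal Y$ and every $l$, $\max_{\mathbb P_l\in\mathcal U_l(y)}\mathbb E_{\mathbb P_l}[h(y,\xi)]$ is attained and equals the infimum of $\alpha+\bar\beta^{\mathsf T}\bar u_l(y)-\underline\beta^{\mathsf T}\underline u_l(y)$ over $\alpha\in\mathbb R$ and $\underline\beta,\bar\beta\in\mathbb R^M_+$ with $\alpha+(\bar\beta-\underline\beta)^{\mathsf T}f(\xi)\ge h(y,\xi)$ for all $\xi\in\Xi_l$. 2. For every $y\in\mathcal Y$, each $\mathbb P\in\Theta(y)$ is a probability measure under which $h(y,\cdot)$ is integrable, the maximum in (A) is attained, and the objective of (A)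 at $y$ equals the infimum of the objective of (B) over all feasible points with first component $y$. 3. The optimal values of (A) and (B) in $[-\infty,\infty]$ coincide. 4. A point $z=(y,\lambda,\eta,r,\alpha,\underline\beta,\bar\beta)$ is optimal for (B) if and only if it is feasible for (B), $y$ is optimal for (A), and the objective of (B) at $z$ equals the objective of (A) at $y$. -/

import Mathlib

open MeasureTheory
open scoped Matrix

noncomputable section

namespace MultimodalDRO

/-- Data of the two-stage multimodal decision-dependent model: first-stage decisions in `ℝ^I`,
second-stage decisions in `ℝ^J` with `S` constraints, uncertainty in `ℝ^N`, `L` modes and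
`M` moment functions. The structure carries data only, no assumption. -/
structure Data (I J N S L M : ℕ) where
  /-- first-stage feasible region -/
  Y : Set (Fin I → ℝ)
  /-- first-stage cost -/
  c : Fin I → ℝ
  Q : Matrix (Fin J) (Fin N) ℝ
  q : Fin J → ℝ
  /-- the technology matrix, an affine function of the first-stage decision -/
  T : (Fin I → ℝ) →ᵃ[ℝ] Matrix (Fin S) (Fin N) ℝ
  W : Matrix (Fin S) (Fin J) ℝ
  /-- the right-hand side, an affine function of the first-stage decision -/
  R : (Fin I → ℝ) →ᵃ[ℝ] (Fin S → ℝ)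
  /-- support set of each mode -/
  Ξ : Fin L → Set (Fin N → ℝ)
  /-- moment functions -/
  f : (Fin N → ℝ) → Fin M → ℝ
  /-- lower moment bounds of each mode -/
  uLow : Fin L → (Fin I → ℝ) → Fin M → ℝ
  /-- upper moment bounds of each mode -/
  uUp : Fin L → (Fin I → ℝ) → Fin M → ℝ
  /-- reference mode probabilities -/
  pHat : (Fin I → ℝ) → Fin L → ℝ
  /-- robustness level -/
  ρ : ℝ

variable {I J N S L M : ℕ}

namespace Data

/-- Feasible second-stage decisions: `T(y) ξ + W x ≥ R(y)`. -/
def recourse (D : Data I J N S L M) (y : Fin I → ℝ) (ξ : Fin N → ℝ) : Set (Fin J → ℝ) :=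
  {x | D.R y ≤ D.T y *ᵥ ξ + D.W *ᵥ x}

/-- Attainable second-stage costs `(Q ξ + q)ᵀ x`. -/
def recourseCosts (D : Data I J N S L M) (y : Fin I → ℝ) (ξ : Fin N → ℝ) : Set ℝ :=
  (fun x => (D.Q *ᵥ ξ + D.q) ⬝ᵥ x) '' D.recourse y ξ

/-- The second-stage cost `h(y, ξ)`. -/
def h (D : Data I J N S L M) (y : Fin I → ℝ) (ξ : Fin N → ℝ) : ℝ :=
  sInf (D.recourseCosts y ξ)

/-- The variation-distance set of mode probabilities. -/
def modeSet (D : Data I J N S L M) (y : Fin I → ℝ) : Set (Fin L → ℝ) :=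
  {p | (∀ l, 0 ≤ p l) ∧ ∑ l, p l = 1 ∧ ∑ l, |p l - D.pHat y l| ≤ D.ρ}

/-- The moment-based ambiguity set `𝒰_l(y)`: Borel probability measures carried by `Ξ_l` whose
moments lie between the bounds. -/
def momentSet (D : Data I J N S L M) (l : Fin L) (y : Fin I → ℝ) : Set (Measure (Fin N → ℝ)) :=
  {P | IsProbabilityMeasure P ∧ P (D.Ξ l)ᶜ = 0 ∧
    ∀ m, ∫ ξ in D.Ξ l, D.f ξ m ∂P ∈ Set.Icc (D.uLow l y m) (D.uUp l y m)}

/-- The multimodal ambiguity set `Θ(y)` of mixtures `∑ p_l P_l`. -/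
def ambiguity (D : Data I J N S L M) (y : Fin I → ℝ) : Set (Measure (Fin N → ℝ)) :=
  {P | ∃ p ∈ D.modeSet y, ∃ Pm : Fin L → Measure (Fin N → ℝ),
    (∀ l, Pm l ∈ D.momentSet l y) ∧ P = ∑ l, ENNReal.ofReal (p l) • Pm l}

/-- Expected second-stage cost `𝔼_P[h(y, ξ)]`. -/
def expCost (D : Data I J N S L M) (y : Fin I → ℝ) (P : Measure (Fin N → ℝ)) : ℝ :=
  ∫ ξ, D.h y ξ ∂P

/-- Objective of the robust model at `y`. -/
def droObj (D : Data I J N S L M) (y : Fin I → ℝ) : EReal :=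
  ((D.c ⬝ᵥ y : ℝ) : EReal) + ⨆ P ∈ D.ambiguity y, (D.expCost y P : EReal)

/-- Optimal value of the robust model. -/
def droValue (D : Data I J N S L M) : EReal := ⨅ y ∈ D.Y, D.droObj y

/-- `y` is an optimal first-stage decision of the robust model. -/
def IsDroOptimal (D : Data I J N S L M) (y : Fin I → ℝ) : Prop :=
  y ∈ D.Y ∧ ∀ y' ∈ D.Y, D.droObj y ≤ D.droObj y'

end Data

/-- Variables `(y, λ, η, r, α, β̲, β̄)` of the semi-infinite program. -/
structure SipVar (I L M : ℕ) where
  y : Fin I → ℝ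
  lam : ℝ
  eta : ℝ
  r : Fin L → ℝ
  α : Fin L → ℝ
  βLow : Fin L → Fin M → ℝ
  βUp : Fin L → Fin M → ℝ

namespace Data

/-- Feasibility for the dual of the moment problem of mode `l` at `y`. -/
def DualFeasible (D : Data I J N S L M) (l : Fin L) (y : Fin I → ℝ)
    (α : ℝ) (βLow βUp : Fin M → ℝ) : Prop :=
  0 ≤ βLow ∧ 0 ≤ βUp ∧ ∀ ξ ∈ D.Ξ l, D.h y ξ ≤ α + (βUp - βLow) ⬝ᵥ D.f ξ

/-- Objective of the dual of the moment problem of mode `l` at `y`. -/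
def dualObj (D : Data I J N S L M) (l : Fin L) (y : Fin I → ℝ)
    (α : ℝ) (βLow βUp : Fin M → ℝ) : ℝ :=
  α + βUp ⬝ᵥ D.uUp l y - βLow ⬝ᵥ D.uLow l y

/-- Feasibility for the semi-infinite program. -/
structure SipFeasible (D : Data I J N S L M) (z : SipVar I L M) : Prop where
  mem : z.y ∈ D.Y
  lam_nonneg : 0 ≤ z.lam
  dual : ∀ l, D.DualFeasible l z.y (z.α l) (z.βLow l) (z.βUp l)
  le_r : ∀ l, D.dualObj l z.y (z.α l) (z.βLow l) (z.βUp l) - z.eta ≤ z.r l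
  le_lam : ∀ l, D.dualObj l z.y (z.α l) (z.βLow l) (z.βUp l) - z.eta ≤ z.lam
  neg_lam_le : ∀ l, -z.lam ≤ z.r l

/-- Objective of the semi-infinite program. -/
def sipObj (D : Data I J N S L M) (z : SipVar I L M) : ℝ :=
  D.c ⬝ᵥ z.y + z.eta + D.ρ * z.lam + ∑ l, D.pHat z.y l * z.r l

/-- Optimal value of the semi-infinite program. -/
def sipValue (D : Data I J N S L M) : EReal :=
  ⨅ (z : SipVar I L M) (_ : D.SipFeasible z), (D.sipObj z : EReal)

/-- `z` is an optimal solution of the semi-infinite program. -/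
def IsSipOptimal (D : Data I J N S L M) (z : SipVar I L M) : Prop :=
  D.SipFeasible z ∧ ∀ z', D.SipFeasible z' → D.sipObj z ≤ D.sipObj z'

end Data

end MultimodalDRO

end

noncomputable section

namespace MultimodalDRO


/-! Fix `y`. A measure in a moment set matters only through its expectations of `f` and `h y`. As
`P` runs over probability measures carried by `Ξ l`, these vectors fill the convex hull of the graph
of `(f, h y)` over `Ξ l`: means lie in it (`integral_mem_convexHull`), and its points come from
finitely supported measures (`exists_measure_of_mem_convexHull`). The hull is compact because `h y`
is continuous on `Ξ l` (`continuousOn_h`), which rests on the continuity of linear programming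
values (`continuousOn_lpValue`). The moment problem thus maximizes one coordinate over a compact
convex set, with the others in a box, so the maximum is attained.

For duality, strictly separate this compact set from the closed set of points over the box at height
at least `v + ε` (`exists_lagrangian_bound`). One feasible point makes the separating functional
non-vertical, so no Slater condition is needed; the price is that dual values are infima, reached
only up to `ε`. The same bound dualizes the variation-distance constraint on mode probabilities
(`exists_modeDual_le`).

Expectation is linear in a mixture, so the worst case over `Θ(y)` is the maximum of `p ⬝ᵥ ψ`, with
`ψ l` the worst case of mode `l`. Joining the two dualities gives the fibrewise identity
`isGLB_sipObj`; the statements on values and optimal points follow from it by order theory. -/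

/-! ### Finitely generated cones -/

section Cones

variable {ι κ E : Type*} [Fintype ι] [Fintype κ]

/-- Conic Carathéodory theorem. -/
theorem exists_linearIndepOn_nonneg_combination [AddCommGroup E] [Module ℝ E] (v : ι → E)
    (w : ι → ℝ) (hw : 0 ≤ w) :
    ∃ w' : ι → ℝ, 0 ≤ w' ∧ (∀ i, w i = 0 → w' i = 0) ∧ ∑ i, w' i • v i = ∑ i, w i • v i ∧
      LinearIndepOn ℝ v {i | w' i ≠ 0} := by
  classical
  -- Induction on the size of the support: while its vectors are dependent, shifting the weights
  -- along a relation kills one of them.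
  induction hn : (Finset.univ.filter fun i => w i ≠ 0).card using Nat.strong_induction_on
    generalizing w with
  | _ n ih =>
  by_cases hli : LinearIndepOn ℝ v {i | w i ≠ 0}
  · exact ⟨w, hw, fun _ h => h, rfl, hli⟩
  have hset : {i | w i ≠ 0} = ((Finset.univ.filter fun i => w i ≠ 0 : Finset ι) : Set ι) := by
    ext; simp
  obtain ⟨g, hgsum, hgsupp, hgpos⟩ : ∃ g : ι → ℝ, ∑ i, g i • v i = 0 ∧
      (∀ i, w i = 0 → g i = 0) ∧ ∃ i, 0 < g i := by
    rw [hset, linearIndepOn_finset_iff] at hli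
    push Not at hli
    obtain ⟨g, hg, i, hi, hgi⟩ := hli
    have key : ∀ a : ℝ, ∑ j, (if w j = 0 then 0 else a * g j) • v j = 0 := by
      intro a
      rw [Finset.sum_filter] at hg
      calc ∑ j, (if w j = 0 then 0 else a * g j) • v j
          = a • ∑ j, (if w j ≠ 0 then g j • v j else 0) := by
            rw [Finset.smul_sum]
            refine Finset.sum_congr rfl fun j _ => ?_
            by_cases h : w j = 0 <;> simp [h, mul_smul]
        _ = 0 := by rw [hg, smul_zero]
    have hwi : w i ≠ 0 := by simpa using hi
    rcases lt_or_gt_of_ne hgi with h | h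
    · refine ⟨fun j => if w j = 0 then 0 else (-1) * g j, key _, fun j hj => by simp [hj], i, ?_⟩
      simp [hwi, h]
    · refine ⟨fun j => if w j = 0 then 0 else 1 * g j, key _, fun j hj => by simp [hj], i, ?_⟩
      simp [hwi, h]
  -- Ratio test: `a` is the largest multiple of `g` that can be subtracted with nonnegative weights
  -- left, and the weight at `i₀` becomes zero.
  obtain ⟨i₀, hi₀, hmin⟩ := (Finset.univ.filter fun i => 0 < g i).exists_min_image
    (fun i => w i / g i) (by obtain ⟨i, hi⟩ := hgpos; exact ⟨i, by simpa using hi⟩)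
  have hgi₀ : 0 < g i₀ := by simpa using hi₀
  set a := w i₀ / g i₀ with ha
  have ha0 : 0 ≤ a := div_nonneg (hw i₀) hgi₀.le
  have hwsub : 0 ≤ fun i => w i - a * g i := by
    intro i
    by_cases hi : 0 < g i
    · have := hmin i (by simpa using hi)
      have := (le_div_iff₀ hi).1 this
      simpa using this
    · have h1 : a * g i ≤ 0 := mul_nonpos_of_nonneg_of_nonpos ha0 (not_lt.1 hi)
      have h2 := hw i
      simp only [Pi.zero_apply] at h2 ⊢
      linarith
  have hsupp : ∀ i, w i = 0 → w i - a * g i = 0 := fun i hi => by simp [hi, hgsupp i hi]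
  have hwi₀ : w i₀ ≠ 0 := fun h => hgi₀.ne' (hgsupp i₀ h)
  have hcard : (Finset.univ.filter fun i => w i - a * g i ≠ 0).card < n := by
    rw [← hn]
    apply Finset.card_lt_card
    rw [Finset.ssubset_iff_of_subset]
    · exact ⟨i₀, by simpa using hwi₀, by simp [ha, hgi₀.ne']⟩
    · intro i hi
      simp only [Finset.mem_filter, Finset.mem_univ, true_and] at hi ⊢
      exact fun h => hi (hsupp i h)
  obtain ⟨w', h1, h2, h3, h4⟩ := ih _ hcard _ hwsub rfl
  refine ⟨w', h1, fun i hi => h2 i (hsupp i hi), ?_, h4⟩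
  rw [h3]
  simp only [sub_smul, mul_smul, Finset.sum_sub_distrib, ← Finset.smul_sum, hgsum, smul_zero,
    sub_zero]

variable [NormedAddCommGroup E] [NormedSpace ℝ E]

/-- A finitely generated cone is closed. -/
theorem isClosed_image_nonneg (B : (ι → ℝ) →ₗ[ℝ] E) : IsClosed (B '' {w | 0 ≤ w}) := by
  classical
  set v : ι → E := fun i => B (Pi.single i 1)
  have hB : ∀ w, B w = ∑ i, w i • v i := fun w => by
    rw [LinearMap.pi_apply_eq_sum_univ B w]
    refine Finset.sum_congr rfl fun i _ => ?_
    congr 2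
    ext j
    simp [Pi.single_apply, eq_comm]
  -- By Carathéodory the cone is a finite union of cones over independent families, each the image
  -- of a closed orthant under a closed embedding.
  have hEq : B '' {w | 0 ≤ w} = ⋃ s ∈ {s : Finset ι | LinearIndepOn ℝ v (s : Set ι)},
      (Fintype.linearCombination ℝ fun i : s => v i) '' {w | 0 ≤ w} := by
    ext e
    simp only [Set.mem_image, Set.mem_ofPred_eq, Set.mem_iUnion, exists_prop]
    constructor
    · rintro ⟨w, hw, rfl⟩
      obtain ⟨w', h0, -, hsum, hli⟩ := exists_linearIndepOn_nonneg_combination v w hw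
      refine ⟨Finset.univ.filter fun i => w' i ≠ 0, by simpa using hli,
        fun i => w' i, fun i => h0 i, ?_⟩
      rw [hB, ← hsum, Fintype.linearCombination_apply,
        Finset.sum_coe_sort (Finset.univ.filter fun i => w' i ≠ 0) (fun i => w' i • v i)]
      exact Finset.sum_filter_of_ne fun i _ h h' => h (by simp [h'])
    · rintro ⟨s, -, w, hw, rfl⟩
      refine ⟨fun i => if h : i ∈ s then w ⟨i, h⟩ else 0, fun i => ?_, ?_⟩
      · by_cases h : i ∈ s
        · simpa [h] using hw ⟨i, h⟩
        · simp [h]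
      · rw [hB, Fintype.linearCombination_apply]
        rw [← Finset.sum_subset s.subset_univ (fun i _ hi => by simp [hi]), ← Finset.sum_coe_sort]
        refine Finset.sum_congr rfl fun i _ => ?_
        simp
  rw [hEq]
  refine (Set.toFinite _).isClosed_biUnion fun s hs => ?_
  have hker : LinearMap.ker (Fintype.linearCombination ℝ fun i : s => v i) = ⊥ :=
    LinearMap.ker_eq_bot.2 (linearIndependent_iff_injective_fintypeLinearCombination.1 hs)
  exact (LinearMap.isClosedEmbedding_of_injective hker).isClosedMap _ isClosed_Ici

/-- The sum of a finite-dimensional subspace and a finitely generated cone is closed. -/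
theorem isClosed_range_add_image_nonneg (A : (κ → ℝ) →ₗ[ℝ] E) (B : (ι → ℝ) →ₗ[ℝ] E) :
    IsClosed {e | ∃ x w, 0 ≤ w ∧ A x + B w = e} := by
  -- Splitting `x` into positive and negative parts turns the subspace into a finitely generated
  -- cone.
  convert isClosed_image_nonneg
    (A ∘ₗ (LinearMap.funLeft ℝ ℝ (Sum.inl : κ → κ ⊕ κ ⊕ ι) -
      LinearMap.funLeft ℝ ℝ (Sum.inr ∘ Sum.inl : κ → κ ⊕ κ ⊕ ι)) +
      B ∘ₗ LinearMap.funLeft ℝ ℝ (Sum.inr ∘ Sum.inr : ι → κ ⊕ κ ⊕ ι)) using 1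
  ext e
  constructor
  · rintro ⟨x, w, hw, rfl⟩
    refine ⟨Sum.elim (fun j => max (x j) 0) (Sum.elim (fun j => max (-x j) 0) w), ?_, ?_⟩
    · rintro (j | j | i)
      · simp
      · simp
      · exact hw i
    · simp only [LinearMap.add_apply, LinearMap.comp_apply]
      congr 2
      ext j
      simp only [LinearMap.sub_apply, LinearMap.funLeft_apply, Pi.sub_apply, Function.comp_apply,
        Sum.elim_inl, Sum.elim_inr]
      rcases le_total 0 (x j) with h | h <;> simp [h]
  · rintro ⟨w, hw, rfl⟩
    exact ⟨_, _, fun i => hw _, rfl⟩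

/-- Farkas' lemma for the rows of a matrix indexed by a finite set. -/
theorem exists_nonneg_vecMul_eq (W : Matrix ι κ ℝ) (s : Finset ι) (c : κ → ℝ)
    (hc : ∀ d, (∀ i ∈ s, 0 ≤ (W *ᵥ d) i) → 0 ≤ c ⬝ᵥ d) :
    ∃ π : ι → ℝ, 0 ≤ π ∧ (∀ i ∉ s, π i = 0) ∧ π ᵥ* W = c := by
  classical
  by_contra hcon
  set B : (ι → ℝ) →ₗ[ℝ] (κ → ℝ) :=
    W.vecMulLinear ∘ₗ LinearMap.pi fun i => if i ∈ s then LinearMap.proj i else 0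
  have hBa : ∀ w, B w = (fun i => if i ∈ s then w i else 0) ᵥ* W := by
    intro w
    simp only [B, LinearMap.comp_apply, Matrix.vecMulLinear_apply]
    congr 1
    ext i
    by_cases h : i ∈ s <;> simp [h]
  have hmem : c ∉ B '' {w | 0 ≤ w} := by
    rintro ⟨w, hw, rfl⟩
    refine hcon ⟨fun i => if i ∈ s then w i else 0, fun i => ?_, fun i hi => by simp [hi],
      (hBa w).symm⟩
    by_cases h : i ∈ s
    · simpa [h] using hw i
    · simp [h]
  have hconv : Convex ℝ (B '' {w | 0 ≤ w}) := (convex_Ici (0 : ι → ℝ)).linear_image B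
  obtain ⟨f, u, hfc, hfu⟩ := geometric_hahn_banach_point_closed hconv (isClosed_image_nonneg B) hmem
  set d : κ → ℝ := fun j => f (Pi.single j 1)
  have hf : ∀ x, f x = x ⬝ᵥ d := by
    intro x
    have := LinearMap.pi_apply_eq_sum_univ f.toLinearMap x
    simp only [ContinuousLinearMap.coe_coe] at this
    rw [this]
    refine Finset.sum_congr rfl fun i _ => ?_
    simp only [smul_eq_mul, d]
    congr 2
    ext j
    simp [Pi.single_apply, eq_comm]
  have hu : u < 0 := by simpa using hfu 0 ⟨0, by simp, by simp⟩
  have hpos : 0 ≤ c ⬝ᵥ d := by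
    refine hc d fun i hi => ?_
    by_contra hneg
    push Not at hneg
    -- This nonnegative multiple of row `i` is scaled so that the functional takes the value `u` on
    -- it, against the strict bound `u < f`.
    have := hfu (B (Pi.single i (u / (W *ᵥ d) i))) ⟨_, ?_, rfl⟩
    · rw [hBa, hf] at this
      have h2 : (fun j => if j ∈ s then (Pi.single i (u / (W *ᵥ d) i) : ι → ℝ) j else 0)
          = Pi.single i (u / (W *ᵥ d) i) := by
        ext j
        by_cases hj : j = i
        · subst hj; simp [hi]
        · simp [hj]
      rw [h2, ← Matrix.dotProduct_mulVec, single_dotProduct, div_mul_cancel₀ _ hneg.ne] at this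
      exact lt_irrefl _ this
    · intro j
      by_cases hj : j = i
      · subst hj; simpa using div_nonneg_of_nonpos hu.le hneg.le
      · simp [hj]
  rw [hf] at hfc
  linarith

end Cones


/-! ### Continuity of the value of a linear program -/

section LinearProgram

variable {ι κ : Type*} [Fintype ι] [Fintype κ]

/-- The value of the linear program `min {cᵀ x : W x ≥ b}`. -/
def lpValue (W : Matrix ι κ ℝ) (b : ι → ℝ) (c : κ → ℝ) : ℝ :=
  sInf ((fun x => c ⬝ᵥ x) '' {x | b ≤ W *ᵥ x})

/-- A feasible linear program of finite value attains it. -/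
theorem exists_lpValue_eq {W : Matrix ι κ ℝ} {b : ι → ℝ} {c : κ → ℝ}
    (hne : {x | b ≤ W *ᵥ x}.Nonempty) (hbdd : BddBelow ((fun x => c ⬝ᵥ x) '' {x | b ≤ W *ᵥ x})) :
    ∃ x, b ≤ W *ᵥ x ∧ c ⬝ᵥ x = lpValue W b c := by
  classical
  set A : (κ → ℝ) →ₗ[ℝ] ℝ × (ι → ℝ) := (dotProductBilin ℝ ℝ c).prod W.mulVecLin
  set B : (Option ι → ℝ) →ₗ[ℝ] ℝ × (ι → ℝ) :=
    (LinearMap.proj none).prod (LinearMap.pi fun i => - LinearMap.proj (some i))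
  -- With slack variables for the rows and the cost, this upper set of values is a preimage of a
  -- subspace plus a finitely generated cone; being closed, it contains the infimum.
  have hclosed : IsClosed {t : ℝ | ∃ x, b ≤ W *ᵥ x ∧ c ⬝ᵥ x ≤ t} := by
    convert (isClosed_range_add_image_nonneg A B).preimage
      (f := fun t : ℝ => (t, b)) (by fun_prop) using 1
    ext t
    simp only [Set.mem_ofPred_eq, Set.mem_preimage]
    constructor
    · rintro ⟨x, hx, ht⟩
      refine ⟨x, fun o => o.elim (t - c ⬝ᵥ x) fun i => (W *ᵥ x) i - b i, ?_, ?_⟩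
      · rintro (_ | i)
        · simpa using ht
        · simpa using hx i
      · ext
        · simp [A, B]
        · simp [A, B]
    · rintro ⟨x, w, hw, hxw⟩
      rw [Prod.ext_iff] at hxw
      refine ⟨x, fun i => ?_, ?_⟩
      · have h1 := congrFun hxw.2 i
        have h2 := hw (some i)
        simp [A, B] at h1 h2
        linarith
      · have h1 := hxw.1
        have h2 := hw none
        simp [A, B] at h1 h2
        linarith
  have hsub : (fun x => c ⬝ᵥ x) '' {x | b ≤ W *ᵥ x} ⊆ {t : ℝ | ∃ x, b ≤ W *ᵥ x ∧ c ⬝ᵥ x ≤ t} := by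
    rintro _ ⟨x, hx, rfl⟩
    exact ⟨x, hx, le_rfl⟩
  obtain ⟨x, hx, hle⟩ :=
    closure_minimal hsub hclosed (csInf_mem_closure (hne.image _) hbdd)
  exact ⟨x, hx, le_antisymm hle (csInf_le hbdd ⟨x, hx, rfl⟩)⟩

/-- A feasible linear program of finite value has an optimal solution together with complementary
multipliers carried by linearly independent rows. -/
theorem exists_complementary_pair {W : Matrix ι κ ℝ} {b : ι → ℝ} {c : κ → ℝ}
    (hne : {x | b ≤ W *ᵥ x}.Nonempty) (hbdd : BddBelow ((fun x => c ⬝ᵥ x) '' {x | b ≤ W *ᵥ x})) :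
    ∃ x π, b ≤ W *ᵥ x ∧ 0 ≤ π ∧ π ᵥ* W = c ∧ (∀ i, π i ≠ 0 → (W *ᵥ x) i = b i) ∧
      LinearIndepOn ℝ (fun i => W i) {i | π i ≠ 0} := by
  classical
  obtain ⟨x, hx, hopt⟩ := exists_lpValue_eq hne hbdd
  have hmin : ∀ x', b ≤ W *ᵥ x' → c ⬝ᵥ x ≤ c ⬝ᵥ x' := fun x' hx' =>
    hopt.le.trans (csInf_le hbdd ⟨x', hx', rfl⟩)
  -- Farkas on the active rows: a direction nonnegative on them stays feasible for small steps, so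
  -- it cannot lower the optimal cost.
  obtain ⟨π, hπ, hsupp, hπc⟩ := exists_nonneg_vecMul_eq W
    (Finset.univ.filter fun i => (W *ᵥ x) i = b i) c (fun d hd => by
      have hev : ∀ᶠ ε : ℝ in nhdsWithin 0 (Set.Ioi 0), b ≤ W *ᵥ (x + ε • d) := by
        simp only [Pi.le_def]
        rw [Filter.eventually_all]
        intro i
        simp only [Matrix.mulVec_add, Matrix.mulVec_smul, Pi.add_apply, Pi.smul_apply, smul_eq_mul]
        by_cases hi : (W *ᵥ x) i = b i
        · filter_upwards [self_mem_nhdsWithin] with ε hε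
          have := mul_nonneg (le_of_lt hε) (hd i (by simpa using hi))
          linarith
        · have hlt : b i < (W *ᵥ x) i := lt_of_le_of_ne (hx i) (Ne.symm hi)
          have hcont : Filter.Tendsto (fun ε : ℝ => (W *ᵥ x) i + ε * (W *ᵥ d) i)
              (nhds 0) (nhds ((W *ᵥ x) i + 0 * (W *ᵥ d) i)) := by
            apply Continuous.tendsto (f := fun ε : ℝ => (W *ᵥ x) i + ε * (W *ᵥ d) i)
            fun_prop
          have := hcont.eventually (lt_mem_nhds (by simpa using hlt))
          exact (this.filter_mono nhdsWithin_le_nhds).mono fun _ h => h.le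
      obtain ⟨ε, hε, hε0⟩ := (hev.and self_mem_nhdsWithin).exists
      have := hmin _ hε
      rw [dotProduct_add, dotProduct_smul, smul_eq_mul] at this
      exact nonneg_of_mul_nonneg_right (by linarith : 0 ≤ ε * (c ⬝ᵥ d)) hε0)
  obtain ⟨π', h0, hs, hsum, hli⟩ :=
    exists_linearIndepOn_nonneg_combination (fun i => W i) π hπ
  refine ⟨x, π', hx, h0, ?_, fun i hi => ?_, hli⟩
  · rw [← hπc, Matrix.vecMul_eq_sum, Matrix.vecMul_eq_sum]
    exact hsum
  · by_contra h
    exact hi (hs i (hsupp i (by simpa using h)))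

/-- Complementarity gives `x` the cost `π ⬝ᵥ b`, and weak duality bounds every other feasible cost
below by it. -/
theorem lpValue_eq_dotProduct {W : Matrix ι κ ℝ} {b : ι → ℝ} {x : κ → ℝ} {π : ι → ℝ}
    (hx : b ≤ W *ᵥ x) (hπ : 0 ≤ π) (hcomp : ∀ i, π i ≠ 0 → (W *ᵥ x) i = b i) :
    lpValue W b (π ᵥ* W) = π ⬝ᵥ b := by
  refine IsLeast.csInf_eq ⟨⟨x, hx, ?_⟩, ?_⟩
  · simp only [← Matrix.dotProduct_mulVec]
    refine Finset.sum_congr rfl fun i _ => ?_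
    by_cases h : π i = 0
    · simp [h]
    · rw [hcomp i h]
  · rintro _ ⟨x', hx', rfl⟩
    simp only [← Matrix.dotProduct_mulVec]
    exact dotProduct_le_dotProduct_of_nonneg_left hx' hπ

/-- The value of a linear program is jointly continuous in its right-hand side and its cost, on the
set where it is feasible and bounded. -/
theorem continuousOn_lpValue (W : Matrix ι κ ℝ) :
    ContinuousOn (fun p : (ι → ℝ) × (κ → ℝ) => lpValue W p.1 p.2)
      {p | {x | p.1 ≤ W *ᵥ x}.Nonempty ∧
        BddBelow ((fun x => p.2 ⬝ᵥ x) '' {x | p.1 ≤ W *ᵥ x})} := by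
  classical
  -- For independent rows `s`, the value on `K s ×ˢ C s` is bilinear: complementarity makes it `π ⬝ᵥ
  -- b`, and a linear left inverse recovers `π` from the cost. Finitely many such closed pieces
  -- cover the domain, so continuity can be glued.
  set K : Finset ι → Set (ι → ℝ) :=
    fun s => {b | ∃ x, b ≤ W *ᵥ x ∧ ∀ i ∈ s, (W *ᵥ x) i = b i}
  set C : Finset ι → Set (κ → ℝ) :=
    fun s => {c | ∃ π : ι → ℝ, 0 ≤ π ∧ (∀ i ∉ s, π i = 0) ∧ π ᵥ* W = c}
  have hKc : ∀ s, IsClosed (K s) := by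
    intro s
    refine Eq.mpr (congrArg IsClosed ?_) (isClosed_range_add_image_nonneg W.mulVecLin
      (LinearMap.pi fun i => if i ∈ s then 0 else - LinearMap.proj i :
        (ι → ℝ) →ₗ[ℝ] (ι → ℝ)))
    ext b
    constructor
    · rintro ⟨x, hx, hs⟩
      refine ⟨x, W *ᵥ x - b, sub_nonneg.2 hx, ?_⟩
      ext i
      by_cases h : i ∈ s
      · simp [h, hs i h]
      · simp [h]
    · rintro ⟨x, w, hw, rfl⟩
      refine ⟨x, fun i => ?_, fun i hi => by simp [hi]⟩
      have := hw i
      by_cases h : i ∈ s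
      · simp [h]
      · simpa [h] using this
  have hCc : ∀ s, IsClosed (C s) := by
    intro s
    refine Eq.mpr (congrArg IsClosed ?_) (isClosed_image_nonneg (W.vecMulLinear ∘ₗ
      LinearMap.pi fun i => if i ∈ s then LinearMap.proj i else 0 : (ι → ℝ) →ₗ[ℝ] (κ → ℝ)))
    ext c
    constructor
    · rintro ⟨π, hπ, hs, rfl⟩
      refine ⟨π, hπ, ?_⟩
      simp only [LinearMap.comp_apply, Matrix.vecMulLinear_apply]
      congr 1
      ext i
      by_cases h : i ∈ s
      · simp [h]
      · simp [h, hs i h]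
    · rintro ⟨w, hw, rfl⟩
      refine ⟨_, fun i => ?_, fun i hi => ?_, rfl⟩
      · by_cases h : i ∈ s
        · simpa [h] using hw i
        · simp [h]
      · simp [hi]
  have hcont : ∀ s : {s : Finset ι // LinearIndepOn ℝ (fun i => W i) (s : Set ι)},
      ContinuousOn (fun p : (ι → ℝ) × (κ → ℝ) => lpValue W p.1 p.2) (K s ×ˢ C s) := by
    rintro ⟨s, hs⟩
    have hker : LinearMap.ker (Fintype.linearCombination ℝ fun i : s => W i) = ⊥ :=
      LinearMap.ker_eq_bot.2 (linearIndependent_iff_injective_fintypeLinearCombination.1 hs)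
    obtain ⟨g, hg⟩ := LinearMap.exists_leftInverse_of_injective _ hker
    have hgc : Continuous g := g.continuous_of_finiteDimensional
    have : ContinuousOn (fun p : (ι → ℝ) × (κ → ℝ) => ∑ i : s, g p.2 i * p.1 i) (K s ×ˢ C s) := by
      apply Continuous.continuousOn
      fun_prop
    refine this.congr ?_
    rintro ⟨b, c⟩ ⟨⟨x, hx, hsx⟩, π, hπ, hsπ, rfl⟩
    have hcomb : π ᵥ* W = Fintype.linearCombination ℝ (fun i : s => W i) fun i => π i := by
      rw [Matrix.vecMul_eq_sum, Fintype.linearCombination_apply,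
        Finset.sum_coe_sort s (fun i => π i • W i)]
      exact (Finset.sum_subset s.subset_univ fun i _ hi => by simp [hsπ i hi]).symm
    have hgπ : g (π ᵥ* W) = fun i : s => π i := by
      rw [hcomb]
      exact LinearMap.congr_fun hg _
    simp only [hgπ]
    rw [lpValue_eq_dotProduct hx hπ
      (fun i hi => hsx i (by by_contra h; exact hi (hsπ i h)))]
    rw [Finset.sum_coe_sort s (fun i => π i * b i)]
    exact (Finset.sum_subset s.subset_univ fun i _ hi => by simp [hsπ i hi]).symm
  refine ((locallyFinite_of_finite _).continuousOn_iUnion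
    (f := fun s : {s : Finset ι // LinearIndepOn ℝ (fun i => W i) (s : Set ι)} => K s ×ˢ C s)
    (fun s => (hKc s.1).prod (hCc s.1)) hcont).mono ?_
  rintro ⟨b, c⟩ ⟨hne, hbdd⟩
  obtain ⟨x, π, hx, hπ, hπc, hcomp, hli⟩ := exists_complementary_pair hne hbdd
  refine Set.mem_iUnion.2 ⟨⟨Finset.univ.filter fun i => π i ≠ 0, by simpa using hli⟩, ?_, ?_⟩
  · exact ⟨x, hx, fun i hi => hcomp i (by simpa using hi)⟩
  · exact ⟨π, hπ, fun i hi => by simpa using hi, hπc⟩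

end LinearProgram

namespace Data

variable {I J N S L M : ℕ} (D : Data I J N S L M)

theorem h_eq_lpValue (y : Fin I → ℝ) (ξ : Fin N → ℝ) :
    D.h y ξ = lpValue D.W (D.R y - D.T y *ᵥ ξ) (D.Q *ᵥ ξ + D.q) := by
  simp only [h, recourseCosts, recourse, lpValue, sub_le_iff_le_add']

/-- The second-stage cost is continuous where the second-stage problem is feasible and bounded. -/
theorem continuousOn_h {y : Fin I → ℝ} {s : Set (Fin N → ℝ)}
    (hfeas : ∀ ξ ∈ s, (D.recourse y ξ).Nonempty)
    (hfin : ∀ ξ ∈ s, BddBelow (D.recourseCosts y ξ)) : ContinuousOn (D.h y) s := by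
  have hmaps : Set.MapsTo (fun ξ => (D.R y - D.T y *ᵥ ξ, D.Q *ᵥ ξ + D.q)) s
      {p | {x | p.1 ≤ D.W *ᵥ x}.Nonempty ∧
        BddBelow ((fun x => p.2 ⬝ᵥ x) '' {x | p.1 ≤ D.W *ᵥ x})} := by
    intro ξ hξ
    have h1 := hfeas ξ hξ
    have h2 := hfin ξ hξ
    simp only [recourseCosts, recourse] at h1 h2
    simp only [Set.mem_ofPred_eq, sub_le_iff_le_add']
    exact ⟨h1, h2⟩
  refine ((continuousOn_lpValue D.W).comp (Continuous.continuousOn ?_) hmaps).congr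
    fun ξ _ => D.h_eq_lpValue y ξ
  fun_prop

end Data


/-! ### Convex duality -/

section Convex

variable {E : Type*} [NormedAddCommGroup E] [NormedSpace ℝ E]

/-- In finite dimension the convex hull of a compact set is compact. -/
theorem isCompact_convexHull_of_isCompact [FiniteDimensional ℝ E] {s : Set E} (hs : IsCompact s) :
    IsCompact (convexHull ℝ s) := by
  -- Carathéodory bounds the number of points needed, so the hull is a finite union of continuous
  -- images of compact sets.
  have hEq : convexHull ℝ s = ⋃ k ∈ Set.Iic (Module.finrank ℝ E + 1),
      (fun p : (Fin k → ℝ) × (Fin k → E) => ∑ i, p.1 i • p.2 i) ''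
        (stdSimplex ℝ (Fin k) ×ˢ Set.univ.pi fun _ => s) := by
    ext x
    simp only [Set.mem_iUnion, Set.mem_image, exists_prop]
    constructor
    · intro hx
      obtain ⟨ι, _, z, w, hz, hai, hw, hsum, rfl⟩ := eq_pos_convex_span_of_mem_convexHull hx
      have hcard : Fintype.card ι ≤ Module.finrank ℝ E + 1 :=
        hai.card_le_finrank_succ.trans (Nat.succ_le_succ (Submodule.finrank_le _))
      set e := (Fintype.equivFin ι).symm
      refine ⟨Fintype.card ι, hcard, (w ∘ e, z ∘ e), ⟨⟨fun i => (hw _).le, ?_⟩, ?_⟩, ?_⟩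
      · exact (e.sum_comp w).trans hsum
      · exact fun i _ => hz ⟨e i, rfl⟩
      · exact e.sum_comp fun i => w i • z i
    · rintro ⟨k, -, ⟨w, z⟩, ⟨hw, hz⟩, rfl⟩
      exact (convex_convexHull ℝ s).sum_mem (fun i _ => hw.1 i) hw.2
        fun i _ => subset_convexHull ℝ s (hz i trivial)
  rw [hEq]
  refine (Set.finite_Iic _).isCompact_biUnion fun k _ => ?_
  exact ((isCompact_stdSimplex ℝ (Fin k)).prod (isCompact_univ_pi fun _ => hs)).image (by fun_prop)

/-- Lagrangian duality, up to any `ε > 0`, for maximizing the last coordinate over the points of a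
compact convex set whose first coordinate satisfies a convex constraint. No constraint
qualification beyond feasibility is needed. -/
theorem exists_lagrangian_bound {K : Set (E × ℝ)} {B : Set E} (hK : IsCompact K)
    (hKc : Convex ℝ K) (hB : IsClosed B) (hBc : Convex ℝ B) (hne : ∃ a ∈ K, a.1 ∈ B) {v : ℝ}
    (hv : ∀ a ∈ K, a.1 ∈ B → a.2 ≤ v) {ε : ℝ} (hε : 0 < ε) :
    ∃ (g : StrongDual ℝ E) (s : ℝ), (∀ a ∈ K, a.2 ≤ s + g a.1) ∧ ∀ b ∈ B, s + g b ≤ v + ε := by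
  obtain ⟨φ, u, w, hφK, huw, hφB⟩ := geometric_hahn_banach_compact_closed hKc hK
    (hBc.prod (convex_Ici (v + ε))) (hB.prod isClosed_Ici) (by
      rw [Set.disjoint_left]
      rintro a haK ⟨haB, hav⟩
      have h1 := hv a haK haB
      have h2 : v + ε ≤ a.2 := hav
      linarith)
  set τ := φ (0, 1)
  have hφ : ∀ x t, φ (x, t) = φ (x, 0) + t * τ := by
    intro x t
    have : ((x, t) : E × ℝ) = (x, 0) + t • (0, 1) := by ext <;> simp
    rw [this, map_add, map_smul, smul_eq_mul]
  obtain ⟨a₀, ha₀K, ha₀B⟩ := hne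
  -- The feasible point lies on one side, and its lift to height `v + ε` on the other; the vertical
  -- coefficient must therefore be positive.
  have hτ : 0 < τ := by
    have h1 := hφK a₀ ha₀K
    have h2 := hφB (a₀.1, v + ε) ⟨ha₀B, Set.self_mem_Ici⟩
    have h3 := hv a₀ ha₀K ha₀B
    rw [← Prod.mk.eta (p := a₀), hφ] at h1
    rw [hφ] at h2
    have h4 : 0 < (v + ε - a₀.2) * τ := by nlinarith
    exact pos_of_mul_pos_right h4 (by linarith)
  -- Solving `φ (x, t) = u` for `t` gives the affine function `s + g`.
  refine ⟨-(τ⁻¹ • φ ∘L ContinuousLinearMap.inl ℝ E ℝ), u / τ, fun a ha => ?_, fun b hb => ?_⟩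
  · have h1 := hφK a ha
    rw [← Prod.mk.eta (p := a), hφ] at h1
    have h2 : a.2 ≤ (u - φ (a.1, 0)) / τ := by rw [le_div_iff₀ hτ]; linarith
    simp only [neg_apply, smul_apply,
      ContinuousLinearMap.comp_apply, ContinuousLinearMap.inl_apply, smul_eq_mul]
    rw [sub_div] at h2
    rw [inv_mul_eq_div]
    linarith
  · have h1 := hφB (b, v + ε) ⟨hb, Set.self_mem_Ici⟩
    rw [hφ] at h1
    have h2 : (u - φ (b, 0)) / τ ≤ v + ε := by rw [div_le_iff₀ hτ]; linarith
    simp only [neg_apply, smul_apply,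
      ContinuousLinearMap.comp_apply, ContinuousLinearMap.inl_apply, smul_eq_mul]
    rw [sub_div] at h2
    rw [inv_mul_eq_div]
    linarith

end Convex

/-! ### Mixtures of measures -/

section Mixtures

variable {ι X : Type*} [Fintype ι] [MeasurableSpace X]

theorem isProbabilityMeasure_mixture {p : ι → ℝ} (hp : ∀ i, 0 ≤ p i) (hsum : ∑ i, p i = 1)
    {P : ι → Measure X} (hP : ∀ i, IsProbabilityMeasure (P i)) :
    IsProbabilityMeasure (∑ i, ENNReal.ofReal (p i) • P i) := by
  constructor
  simp only [Measure.coe_finsetSum, Finset.sum_apply, Measure.smul_apply, measure_univ,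
    smul_eq_mul, mul_one]
  rw [← ENNReal.ofReal_sum_of_nonneg fun i _ => hp i, hsum, ENNReal.ofReal_one]

theorem integrable_mixture (p : ι → ℝ) {P : ι → Measure X} {φ : X → ℝ}
    (hφ : ∀ i, Integrable φ (P i)) : Integrable φ (∑ i, ENNReal.ofReal (p i) • P i) :=
  integrable_finsetSum_measure.2 fun i _ => (hφ i).smul_measure ENNReal.ofReal_ne_top

theorem integral_mixture {p : ι → ℝ} (hp : ∀ i, 0 ≤ p i) {P : ι → Measure X} {φ : X → ℝ}
    (hφ : ∀ i, Integrable φ (P i)) :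
    ∫ x, φ x ∂(∑ i, ENNReal.ofReal (p i) • P i) = ∑ i, p i * ∫ x, φ x ∂(P i) := by
  rw [integral_finsetSum_measure fun i _ => (hφ i).smul_measure ENNReal.ofReal_ne_top]
  refine Finset.sum_congr rfl fun i _ => ?_
  rw [integral_smul_measure, ENNReal.toReal_ofReal (hp i), smul_eq_mul]

end Mixtures


namespace Data

variable {I J N S L M : ℕ} {D : Data I J N S L M} {y : Fin I → ℝ} {l : Fin L}

/-! ### The moment problem of a mode -/

section Moment

variable {P : Measure (Fin N → ℝ)}

theorem restrict_eq_self_of_mem_momentSet (hP : P ∈ D.momentSet l y) : P.restrict (D.Ξ l) = P :=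
  Measure.restrict_eq_self_of_ae_mem (mem_ae_iff.2 hP.2.1)

theorem integrable_of_mem_momentSet {F : Type*} [NormedAddCommGroup F] {φ : (Fin N → ℝ) → F}
    (hΞ : IsCompact (D.Ξ l)) (hφ : ContinuousOn φ (D.Ξ l)) (hP : P ∈ D.momentSet l y) :
    Integrable φ P := by
  have := hP.1
  have h := hφ.integrableOn_compact (μ := P) hΞ
  rwa [IntegrableOn, restrict_eq_self_of_mem_momentSet hP] at h

theorem integral_mem_Icc_of_mem_momentSet (hP : P ∈ D.momentSet l y) (m : Fin M) :
    ∫ ξ, D.f ξ m ∂P ∈ Set.Icc (D.uLow l y m) (D.uUp l y m) := by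
  have := hP.2.2 m
  rwa [restrict_eq_self_of_mem_momentSet hP] at this

/-- Weak duality for the moment problem. -/
theorem expCost_le_dualObj (hΞ : IsCompact (D.Ξ l)) (hf : ContinuousOn D.f (D.Ξ l))
    (hh : ContinuousOn (D.h y) (D.Ξ l)) (hP : P ∈ D.momentSet l y) {α : ℝ}
    {βLow βUp : Fin M → ℝ} (hd : D.DualFeasible l y α βLow βUp) :
    D.expCost y P ≤ D.dualObj l y α βLow βUp := by
  have := hP.1
  obtain ⟨hLow, hUp, hle⟩ := hd
  have hfi : ∀ m, Integrable (fun ξ => D.f ξ m) P := fun m =>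
    integrable_of_mem_momentSet hΞ (continuousOn_pi.1 hf m) hP
  have hsi : Integrable (fun ξ => (βUp - βLow) ⬝ᵥ D.f ξ) P :=
    integrable_finsetSum _ fun m _ => (hfi m).const_mul _
  have h1 : D.expCost y P ≤ ∫ ξ, α + (βUp - βLow) ⬝ᵥ D.f ξ ∂P := by
    refine integral_mono_ae (integrable_of_mem_momentSet hΞ hh hP)
      ((integrable_const α).add hsi) ?_
    filter_upwards [mem_ae_iff.2 hP.2.1] with ξ hξ using hle ξ hξ
  have h2 : ∫ ξ, α + (βUp - βLow) ⬝ᵥ D.f ξ ∂P =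
      α + ∑ m, (βUp m - βLow m) * ∫ ξ, D.f ξ m ∂P := by
    rw [integral_add (integrable_const α) hsi]
    simp only [dotProduct, Pi.sub_apply]
    rw [integral_finsetSum _ fun m _ => (hfi m).const_mul _]
    simp [integral_const_mul]
  have h3 : ∑ m, (βUp m - βLow m) * ∫ ξ, D.f ξ m ∂P ≤
      βUp ⬝ᵥ D.uUp l y - βLow ⬝ᵥ D.uLow l y := by
    simp only [dotProduct, ← Finset.sum_sub_distrib]
    refine Finset.sum_le_sum fun m _ => ?_
    have h := integral_mem_Icc_of_mem_momentSet hP m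
    have h4 := mul_le_mul_of_nonneg_left h.2 (hUp m)
    have h5 := mul_le_mul_of_nonneg_left h.1 (hLow m)
    linarith
  rw [h2] at h1
  rw [dualObj]
  linarith

/-- Every point of the convex hull of the graph of `(f, h)` over the support is the vector of
expectations of a finitely supported probability measure. -/
theorem exists_measure_of_mem_convexHull {a : (Fin M → ℝ) × ℝ}
    (ha : a ∈ convexHull ℝ ((fun ξ => (D.f ξ, D.h y ξ)) '' D.Ξ l))
    (hbox : a.1 ∈ Set.Icc (D.uLow l y) (D.uUp l y)) :
    ∃ P ∈ D.momentSet l y, D.expCost y P = a.2 := by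
  obtain ⟨ι, _, w, z, hw, hsum, hz, rfl⟩ := mem_convexHull_iff_exists_fintype.1 ha
  choose ξ hξ hzξ using hz
  -- Every function is integrable against a Dirac mass, so no regularity of `f` or `h` off the
  -- supports is needed.
  have hint : ∀ (φ : (Fin N → ℝ) → ℝ) i, Integrable φ (Measure.dirac (ξ i)) :=
    fun φ i => integrable_dirac (by simp)
  have hnull : (∑ i, ENNReal.ofReal (w i) • Measure.dirac (ξ i)) (D.Ξ l)ᶜ = 0 := by
    simp only [Measure.coe_finsetSum, Finset.sum_apply, Measure.smul_apply, smul_eq_mul]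
    refine Finset.sum_eq_zero fun i _ => ?_
    rw [Measure.dirac_apply, Set.indicator_of_notMem (by simpa using hξ i), mul_zero]
  refine ⟨∑ i, ENNReal.ofReal (w i) • Measure.dirac (ξ i),
    ⟨isProbabilityMeasure_mixture hw hsum fun i => inferInstance, hnull, fun m => ?_⟩, ?_⟩
  · rw [Measure.restrict_eq_self_of_ae_mem (mem_ae_iff.2 hnull), integral_mixture hw (hint _)]
    have : ∑ i, w i * ∫ x, D.f x m ∂(Measure.dirac (ξ i)) = (∑ i, w i • z i).1 m := by
      simp [Prod.fst_sum, ← hzξ]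
    rw [this]
    exact ⟨hbox.1 m, hbox.2 m⟩
  · rw [expCost, integral_mixture hw (hint _)]
    simp [Prod.snd_sum, ← hzξ]

/-- A mean lies in any closed convex set carrying the measure; the hull is closed because the graph
over `Ξ l` is compact. -/
theorem integral_mem_convexHull (hΞ : IsCompact (D.Ξ l)) (hf : ContinuousOn D.f (D.Ξ l))
    (hh : ContinuousOn (D.h y) (D.Ξ l)) (hP : P ∈ D.momentSet l y) :
    ((fun m => ∫ ξ, D.f ξ m ∂P), D.expCost y P) ∈
      convexHull ℝ ((fun ξ => (D.f ξ, D.h y ξ)) '' D.Ξ l) := by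
  have := hP.1
  have hcont : ContinuousOn (fun ξ => (D.f ξ, D.h y ξ)) (D.Ξ l) := hf.prodMk hh
  have hmem := (convex_convexHull ℝ ((fun ξ => (D.f ξ, D.h y ξ)) '' D.Ξ l)).integral_mem
    (isCompact_convexHull_of_isCompact (hΞ.image_of_continuousOn hcont)).isClosed
    (μ := P) (f := fun ξ => (D.f ξ, D.h y ξ))
    (by
      filter_upwards [mem_ae_iff.2 hP.2.1] with ξ hξ
      exact subset_convexHull ℝ _ ⟨ξ, hξ, rfl⟩)
    (integrable_of_mem_momentSet hΞ hcont hP)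
  rw [integral_pair (integrable_of_mem_momentSet hΞ hf hP)
    (integrable_of_mem_momentSet hΞ hh hP)] at hmem
  have hfst : (fun m => ∫ ξ, D.f ξ m ∂P) = ∫ ξ, D.f ξ ∂P := by
    ext m
    rw [eval_integral fun m => integrable_of_mem_momentSet hΞ (continuousOn_pi.1 hf m) hP]
  rwa [hfst]

/-- The maximum of the moment problem is attained. -/
theorem exists_isGreatest_expCost_momentSet (hΞ : IsCompact (D.Ξ l))
    (hf : ContinuousOn D.f (D.Ξ l)) (hh : ContinuousOn (D.h y) (D.Ξ l))
    (hU : (D.momentSet l y).Nonempty) :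
    ∃ ψ : ℝ, IsGreatest (D.expCost y '' D.momentSet l y) ψ := by
  set K := convexHull ℝ ((fun ξ => (D.f ξ, D.h y ξ)) '' D.Ξ l)
  have hK : IsCompact K :=
    isCompact_convexHull_of_isCompact (hΞ.image_of_continuousOn (hf.prodMk hh))
  have hmem : ∀ P ∈ D.momentSet l y, ((fun m => ∫ ξ, D.f ξ m ∂P), D.expCost y P) ∈
      K ∩ Prod.fst ⁻¹' Set.Icc (D.uLow l y) (D.uUp l y) := fun P hP =>
    ⟨integral_mem_convexHull hΞ hf hh hP,
      fun m => (integral_mem_Icc_of_mem_momentSet hP m).1,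
      fun m => (integral_mem_Icc_of_mem_momentSet hP m).2⟩
  obtain ⟨P₀, hP₀⟩ := hU
  obtain ⟨a, ⟨haK, hab⟩, hmax⟩ :=
    (hK.inter_right (isClosed_Icc.preimage continuous_fst)).exists_isMaxOn
      ⟨_, hmem P₀ hP₀⟩ continuous_snd.continuousOn
  obtain ⟨P, hP, hPa⟩ := exists_measure_of_mem_convexHull haK hab
  refine ⟨a.2, ⟨P, hP, hPa⟩, ?_⟩
  rintro _ ⟨P', hP', rfl⟩
  exact hmax (hmem P' hP')

/-- Strong duality for the moment problem, up to any `ε > 0`. -/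
theorem exists_dualFeasible_dualObj_le (hΞ : IsCompact (D.Ξ l)) (hf : ContinuousOn D.f (D.Ξ l))
    (hh : ContinuousOn (D.h y) (D.Ξ l)) (hU : (D.momentSet l y).Nonempty) {ψ : ℝ}
    (hψ : ψ ∈ upperBounds (D.expCost y '' D.momentSet l y)) {ε : ℝ} (hε : 0 < ε) :
    ∃ α βLow βUp, D.DualFeasible l y α βLow βUp ∧ D.dualObj l y α βLow βUp ≤ ψ + ε := by
  obtain ⟨P₀, hP₀⟩ := hU
  have hbox₀ : (fun m => ∫ ξ, D.f ξ m ∂P₀) ∈ Set.Icc (D.uLow l y) (D.uUp l y) :=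
    ⟨fun m => (integral_mem_Icc_of_mem_momentSet hP₀ m).1,
      fun m => (integral_mem_Icc_of_mem_momentSet hP₀ m).2⟩
  obtain ⟨g, s, hgK, hgB⟩ := exists_lagrangian_bound
    (isCompact_convexHull_of_isCompact (hΞ.image_of_continuousOn (hf.prodMk hh)))
    (convex_convexHull ℝ _) isClosed_Icc (convex_Icc (D.uLow l y) (D.uUp l y))
    ⟨_, integral_mem_convexHull hΞ hf hh hP₀, hbox₀⟩
    (v := ψ) (fun a haK hab => by
      obtain ⟨P, hP, hPa⟩ := exists_measure_of_mem_convexHull haK hab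
      exact hPa ▸ hψ ⟨P, hP, rfl⟩) hε
  set γ : Fin M → ℝ := fun m => g (Pi.single m 1)
  have hg : ∀ x, g x = γ ⬝ᵥ x := by
    intro x
    have := LinearMap.pi_apply_eq_sum_univ g.toLinearMap x
    simp only [ContinuousLinearMap.coe_coe] at this
    rw [this]
    refine Finset.sum_congr rfl fun i _ => ?_
    rw [smul_eq_mul, mul_comm]
    congr 2
    ext j
    simp [Pi.single_apply, eq_comm]
  -- The multipliers are the negative and positive parts of the slope `γ`, one for each side of the
  -- box.
  refine ⟨s, fun m => max (-γ m) 0, fun m => max (γ m) 0,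
    ⟨fun m => le_max_right _ _, fun m => le_max_right _ _, fun ξ hξ => ?_⟩, ?_⟩
  · have h1 := hgK _ (subset_convexHull ℝ _ ⟨ξ, hξ, rfl⟩)
    have h2 : (fun m => max (γ m) 0) - (fun m => max (-γ m) 0) = γ := by
      ext m
      rcases le_total 0 (γ m) with h | h <;> simp [h]
    rw [h2, ← hg]
    exact h1
  · have hle : D.uLow l y ≤ D.uUp l y := hbox₀.1.trans hbox₀.2
    -- This vertex maximizes `γ` over the box, and `s + g` there is exactly the dual objective.
    have h1 := hgB (fun m => if 0 ≤ γ m then D.uUp l y m else D.uLow l y m)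
      ⟨fun m => by dsimp only; split_ifs <;> [exact hle m; exact le_rfl],
        fun m => by dsimp only; split_ifs <;> [exact le_rfl; exact hle m]⟩
    rw [hg] at h1
    refine le_of_eq_of_le ?_ h1
    rw [dualObj, add_sub_assoc]
    congr 1
    simp only [dotProduct, ← Finset.sum_sub_distrib]
    refine Finset.sum_congr rfl fun m _ => ?_
    by_cases h : 0 ≤ γ m
    · simp [h]
    · simp [h, (not_le.1 h).le]

end Moment

/-! ### The problem over the mode probabilities -/

section Modes

theorem isCompact_modeSet : IsCompact (D.modeSet y) := by
  have : D.modeSet y = stdSimplex ℝ (Fin L) ∩ {p | ∑ l, |p l - D.pHat y l| ≤ D.ρ} := by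
    ext p
    simp [modeSet, stdSimplex, and_assoc]
  rw [this]
  exact (isCompact_stdSimplex ℝ _).inter_right (isClosed_le (by fun_prop) continuous_const)

theorem pHat_mem_modeSet (hp : ∀ l, 0 ≤ D.pHat y l) (hp_sum : ∑ l, D.pHat y l = 1)
    (hρ : 0 ≤ D.ρ) : D.pHat y ∈ D.modeSet y :=
  ⟨hp, hp_sum, by simpa using hρ⟩

/-- Weak duality for the problem over the mode probabilities. -/
theorem dotProduct_le_of_mem_modeSet (hp : ∀ l, 0 ≤ D.pHat y l) {p ψ r : Fin L → ℝ}
    {lam eta : ℝ} (hpm : p ∈ D.modeSet y) (hlam : 0 ≤ lam) (hr : ∀ l, ψ l - eta ≤ r l)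
    (hl : ∀ l, ψ l - eta ≤ lam) (hrl : ∀ l, -lam ≤ r l) :
    p ⬝ᵥ ψ ≤ eta + D.ρ * lam + ∑ l, D.pHat y l * r l := by
  obtain ⟨hp0, hsum, hdist⟩ := hpm
  -- The truncation `t` still dominates `ψ l - eta` and lies in `[-lam, lam]`; write `p l` as `pHat`
  -- plus a deviation, the latter priced at `lam`.
  have key : ∀ l, p l * (ψ l - eta) ≤ D.pHat y l * r l + |p l - D.pHat y l| * lam := by
    intro l
    set t := min (r l) lam
    have h1 : p l * (ψ l - eta) ≤ p l * t :=
      mul_le_mul_of_nonneg_left (le_min (hr l) (hl l)) (hp0 l)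
    have h2 : D.pHat y l * t ≤ D.pHat y l * r l :=
      mul_le_mul_of_nonneg_left (min_le_left _ _) (hp l)
    have h3 : |t| ≤ lam := abs_le.2 ⟨le_min (hrl l) (by linarith), min_le_right _ _⟩
    have h4 : (p l - D.pHat y l) * t ≤ |p l - D.pHat y l| * lam := by
      calc (p l - D.pHat y l) * t ≤ |(p l - D.pHat y l) * t| := le_abs_self _
        _ = |p l - D.pHat y l| * |t| := abs_mul _ _
        _ ≤ _ := mul_le_mul_of_nonneg_left h3 (abs_nonneg _)
    linarith
  have h1 := Finset.sum_le_sum fun l (_ : l ∈ Finset.univ) => key l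
  simp only [Finset.sum_add_distrib, mul_sub, Finset.sum_sub_distrib, ← Finset.sum_mul, hsum] at h1
  have h2 := mul_le_mul_of_nonneg_right hdist hlam
  simp only [dotProduct]
  linarith

/-- Strong duality for the problem over the mode probabilities, up to any `ε > 0`. -/
theorem exists_modeDual_le (hp : ∀ l, 0 ≤ D.pHat y l) (hp_sum : ∑ l, D.pHat y l = 1)
    (hρ : 0 ≤ D.ρ) {ψ : Fin L → ℝ} {v : ℝ} (hv : ∀ p ∈ D.modeSet y, p ⬝ᵥ ψ ≤ v) {ε : ℝ}
    (hε : 0 < ε) :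
    ∃ (lam eta : ℝ) (r : Fin L → ℝ), 0 ≤ lam ∧ (∀ l, ψ l - eta ≤ r l) ∧
      (∀ l, ψ l - eta ≤ lam) ∧ (∀ l, -lam ≤ r l) ∧
      eta + D.ρ * lam + ∑ l, D.pHat y l * r l ≤ v + ε := by
  classical
  have : Nonempty (Fin L) := by
    by_contra h
    rw [not_nonempty_iff] at h
    simp at hp_sum
  -- An epigraph variable above the distance makes the set convex. The cap `2` makes it compact and
  -- loses nothing, as it bounds the distance between two probability vectors.
  set A : Set ((Fin L → ℝ) × ℝ) :=
    {q | q.1 ∈ stdSimplex ℝ (Fin L) ∧ ∑ l, |q.1 l - D.pHat y l| ≤ q.2 ∧ q.2 ≤ 2}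
  have hdist : ∀ p ∈ stdSimplex ℝ (Fin L), ∑ l, |p l - D.pHat y l| ≤ 2 := by
    intro p hpm
    calc ∑ l, |p l - D.pHat y l| ≤ ∑ l, (p l + D.pHat y l) :=
          Finset.sum_le_sum fun l _ => by
            have := hpm.1 l
            have := hp l
            exact abs_le.2 ⟨by linarith, by linarith⟩
      _ = 2 := by rw [Finset.sum_add_distrib, hpm.2, hp_sum]; norm_num
  have hAcompact : IsCompact A := by
    refine ((isCompact_stdSimplex ℝ (Fin L)).prod
      (isCompact_Icc (a := (0 : ℝ)) (b := 2))).of_isClosed_subset ?_ ?_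
    · refine ((isClosed_stdSimplex ℝ (Fin L)).preimage continuous_fst).inter
        ((isClosed_le ?_ continuous_snd).inter (isClosed_le continuous_snd continuous_const))
      fun_prop
    · rintro ⟨p, u⟩ ⟨h1, h2, h3⟩
      exact ⟨h1, (Finset.sum_nonneg fun _ _ => abs_nonneg _).trans h2, h3⟩
  have hAconvex : Convex ℝ A := by
    rintro ⟨p, u⟩ ⟨h1, h2, h3⟩ ⟨p', u'⟩ ⟨h1', h2', h3'⟩ a b ha hb hab
    refine ⟨convex_stdSimplex ℝ (Fin L) h1 h1' ha hb hab, ?_, ?_⟩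
    · simp only [Prod.fst_add, Prod.smul_fst, Prod.snd_add, Prod.smul_snd, Pi.add_apply,
        Pi.smul_apply, smul_eq_mul]
      calc ∑ l, |a * p l + b * p' l - D.pHat y l|
          ≤ ∑ l, (a * |p l - D.pHat y l| + b * |p' l - D.pHat y l|) :=
            Finset.sum_le_sum fun l _ => by
              have : a * p l + b * p' l - D.pHat y l =
                  a * (p l - D.pHat y l) + b * (p' l - D.pHat y l) := by
                linear_combination D.pHat y l * hab
              rw [this]
              refine (abs_add_le _ _).trans_eq ?_
              rw [abs_mul, abs_mul, abs_of_nonneg ha, abs_of_nonneg hb]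
        _ ≤ a * u + b * u' := by
            rw [Finset.sum_add_distrib, ← Finset.mul_sum, ← Finset.mul_sum]
            exact add_le_add (mul_le_mul_of_nonneg_left h2 ha) (mul_le_mul_of_nonneg_left h2' hb)
    · simp only [Prod.snd_add, Prod.smul_snd, smul_eq_mul] at h3 h3' ⊢
      nlinarith
  set F : (Fin L → ℝ) × ℝ →ₗ[ℝ] ℝ × ℝ :=
    (LinearMap.snd ℝ _ _).prod (dotProductBilin ℝ ℝ ψ ∘ₗ LinearMap.fst ℝ _ _)
  have hF : ∀ p u, F (p, u) = (u, p ⬝ᵥ ψ) := fun p u => by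
    simp [F, dotProduct_comm]
  obtain ⟨g, s, hgK, hgB⟩ := exists_lagrangian_bound (K := F '' A) (B := Set.Iic D.ρ)
    (hAcompact.image F.continuous_of_finiteDimensional) (hAconvex.linear_image F)
    isClosed_Iic (convex_Iic _)
    ⟨_, ⟨(D.pHat y, 0), ⟨⟨hp, hp_sum⟩, by simp, by norm_num⟩, rfl⟩, by simpa [hF] using hρ⟩
    (v := v) (by
      rintro _ ⟨⟨p, u⟩, ⟨h1, h2, -⟩, rfl⟩ hu
      rw [hF] at hu ⊢
      exact hv p ⟨h1.1, h1.2, h2.trans hu⟩) hε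
  set lam := g 1
  have hg : ∀ t, g t = lam * t := by
    intro t
    rw [mul_comm, ← smul_eq_mul, ← map_smul, smul_eq_mul, mul_one]
  have hlam : 0 ≤ lam := by
    by_contra hneg
    push Not at hneg
    -- The constraint half-line is unbounded below; were `lam` negative, `s + g` would exceed `v +
    -- ε` at this point.
    have h1 := hgB (min D.ρ ((v + ε - s + 1) / lam)) (Set.mem_Iic.2 (min_le_left _ _))
    have h2 := mul_le_mul_of_nonpos_left (min_le_right D.ρ ((v + ε - s + 1) / lam)) hneg.le
    rw [mul_div_cancel₀ _ hneg.ne] at h2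
    rw [hg] at h1
    linarith
  have hlag : ∀ p ∈ stdSimplex ℝ (Fin L),
      p ⬝ᵥ ψ ≤ v + ε - D.ρ * lam + lam * ∑ l, |p l - D.pHat y l| := by
    intro p hpm
    have h1 := hgK _ ⟨(p, ∑ l, |p l - D.pHat y l|), ⟨hpm, le_rfl, hdist p hpm⟩, rfl⟩
    have h2 := hgB D.ρ Set.self_mem_Iic
    rw [hF, hg] at h1
    rw [hg] at h2
    simp only at h1
    linarith
  obtain ⟨l₀, hl₀⟩ := Finite.exists_max ψ
  -- the worst perturbation moves all modes of small cost to the most expensive one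
  set m := ∑ l, if ψ l₀ - ψ l ≤ 2 * lam then 0 else D.pHat y l with hm
  have hm0 : 0 ≤ m := Finset.sum_nonneg fun l _ => by
    split_ifs
    exacts [le_rfl, hp l]
  -- Moving a unit of mass to `l₀` adds at most `2` to the distance, hence the threshold `2 * lam`
  -- on the gain. Mode `l₀` keeps its own mass, and `m` is the total moved.
  set p : Fin L → ℝ := fun l =>
    (if ψ l₀ - ψ l ≤ 2 * lam then D.pHat y l else 0) + if l = l₀ then m else 0
  have hsplit : ∑ l, (if ψ l₀ - ψ l ≤ 2 * lam then D.pHat y l else 0) = 1 - m := by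
    rw [eq_sub_iff_add_eq, hm, ← Finset.sum_add_distrib, ← hp_sum]
    refine Finset.sum_congr rfl fun l _ => ?_
    split_ifs <;> simp
  have hpm : p ∈ stdSimplex ℝ (Fin L) := by
    refine ⟨fun l => add_nonneg ?_ ?_, ?_⟩
    · split_ifs
      exacts [hp l, le_rfl]
    · split_ifs
      exacts [hm0, le_rfl]
    · simp only [p, Finset.sum_add_distrib, hsplit]
      simp
  have hpd : ∑ l, |p l - D.pHat y l| ≤ 2 * m := by
    have hle : ∀ l, |p l - D.pHat y l| ≤
        (if ψ l₀ - ψ l ≤ 2 * lam then 0 else D.pHat y l) + if l = l₀ then m else 0 := by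
      intro l
      have := hp l
      have : 0 ≤ if l = l₀ then m else 0 := by split_ifs; exacts [hm0, le_rfl]
      simp only [p]
      split_ifs at this ⊢ <;> exact abs_le.2 ⟨by linarith, by linarith⟩
    refine (Finset.sum_le_sum fun l _ => hle l).trans_eq ?_
    rw [Finset.sum_add_distrib, ← hm]
    simp
    ring
  have hpψ : p ⬝ᵥ ψ = (∑ l, if ψ l₀ - ψ l ≤ 2 * lam then D.pHat y l * ψ l else 0) + m * ψ l₀ := by
    simp only [dotProduct, p, add_mul, Finset.sum_add_distrib, ite_mul, zero_mul]
    simp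
  have hfinal := hlag p hpm
  rw [hpψ] at hfinal
  have hmul := mul_le_mul_of_nonneg_left hpd hlam
  -- `eta` is the least value allowed by the bounds by `lam`, and `r l` is then the least admissible
  -- value, `max (ψ l - eta) (-lam)`. The objective becomes `D.ρ * lam + p ⬝ᵥ ψ - 2 * lam * m`,
  -- which the Lagrangian bound at `p` controls.
  refine ⟨lam, ψ l₀ - lam,
    fun l => if ψ l₀ - ψ l ≤ 2 * lam then ψ l - ψ l₀ + lam else -lam, hlam,
    fun l => ?_, fun l => ?_, fun l => ?_, ?_⟩
  · dsimp only
    split_ifs with h <;> linarith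
  · linarith [hl₀ l]
  · dsimp only
    split_ifs with h <;> linarith
  · have hsum : ∑ l, D.pHat y l * (if ψ l₀ - ψ l ≤ 2 * lam then ψ l - ψ l₀ + lam else -lam) =
        (∑ l, if ψ l₀ - ψ l ≤ 2 * lam then D.pHat y l * ψ l else 0) +
          (1 - m) * (lam - ψ l₀) - m * lam := by
      rw [← hsplit, hm, Finset.sum_mul, Finset.sum_mul, ← Finset.sum_add_distrib,
        ← Finset.sum_sub_distrib]
      refine Finset.sum_congr rfl fun l _ => ?_
      split_ifs <;> ring
    rw [hsum]
    linarith

end Modes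

end Data


namespace Data

variable {I J N S L M : ℕ} {D : Data I J N S L M} {y : Fin I → ℝ}

/-! ### The robust model at a fixed decision -/

theorem isProbabilityMeasure_and_integrable_of_mem_ambiguity (hΞ : ∀ l, IsCompact (D.Ξ l))
    (hh : ∀ l, ContinuousOn (D.h y) (D.Ξ l)) {P : Measure (Fin N → ℝ)} (hP : P ∈ D.ambiguity y) :
    IsProbabilityMeasure P ∧ Integrable (D.h y) P := by
  obtain ⟨p, hp, Pm, hPm, rfl⟩ := hP
  exact ⟨isProbabilityMeasure_mixture hp.1 hp.2.1 fun l => (hPm l).1,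
    integrable_mixture p fun l => integrable_of_mem_momentSet (hΞ l) (hh l) (hPm l)⟩

/-- The worst-case expectation over the ambiguity set is attained, and it is the maximum over the
mode probabilities of the mean of the worst-case expectations of the modes. -/
theorem exists_isGreatest_expCost_ambiguity (hp : ∀ l, 0 ≤ D.pHat y l)
    (hp_sum : ∑ l, D.pHat y l = 1) (hρ : 0 ≤ D.ρ) (hΞ : ∀ l, IsCompact (D.Ξ l))
    (hh : ∀ l, ContinuousOn (D.h y) (D.Ξ l)) {ψ : Fin L → ℝ}
    (hψ : ∀ l, IsGreatest (D.expCost y '' D.momentSet l y) (ψ l)) :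
    ∃ v, IsGreatest (D.expCost y '' D.ambiguity y) v ∧
      IsGreatest ((fun p => p ⬝ᵥ ψ) '' D.modeSet y) v := by
  obtain ⟨p, hpm, hmax⟩ := (isCompact_modeSet (D := D) (y := y)).exists_isMaxOn
    ⟨_, pHat_mem_modeSet hp hp_sum hρ⟩ (f := fun p => p ⬝ᵥ ψ)
    (by unfold dotProduct; fun_prop)
  -- Linearity with nonnegative weights lets each mode be maximized separately.
  have hmix : ∀ q ∈ D.modeSet y, ∀ Pm : Fin L → Measure (Fin N → ℝ),
      (∀ l, Pm l ∈ D.momentSet l y) →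
      D.expCost y (∑ l, ENNReal.ofReal (q l) • Pm l) = ∑ l, q l * D.expCost y (Pm l) :=
    fun q hq Pm hPm =>
      integral_mixture hq.1 fun l => integrable_of_mem_momentSet (hΞ l) (hh l) (hPm l)
  refine ⟨p ⬝ᵥ ψ, ⟨?_, ?_⟩, ⟨p, hpm, rfl⟩, ?_⟩
  · choose Pm hPm hPψ using fun l => (hψ l).1
    refine ⟨_, ⟨p, hpm, Pm, hPm, rfl⟩, ?_⟩
    rw [hmix p hpm Pm hPm]
    simp only [hPψ, dotProduct]
  · rintro _ ⟨_, ⟨q, hq, Pm, hPm, rfl⟩, rfl⟩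
    rw [hmix q hq Pm hPm]
    refine le_trans ?_ (hmax hq)
    exact Finset.sum_le_sum fun l _ =>
      mul_le_mul_of_nonneg_left ((hψ l).2 ⟨_, hPm l, rfl⟩) (hq.1 l)
  · rintro _ ⟨q, hq, rfl⟩
    exact hmax hq

theorem droObj_eq_coe {v : ℝ} (hv : IsGreatest (D.expCost y '' D.ambiguity y) v) :
    D.droObj y = ((D.c ⬝ᵥ y + v : ℝ) : EReal) := by
  have : ⨆ P ∈ D.ambiguity y, (D.expCost y P : EReal) = (v : EReal) := by
    refine le_antisymm (iSup₂_le fun P hP => EReal.coe_le_coe_iff.2 (hv.2 ⟨P, hP, rfl⟩)) ?_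
    obtain ⟨P, hP, rfl⟩ := hv.1
    exact le_iSup₂ (f := fun P (_ : P ∈ D.ambiguity y) => (D.expCost y P : EReal)) P hP
  rw [droObj, this, EReal.coe_add]

/-- At a fixed decision, the worst-case cost is the infimum of the semi-infinite program over the
remaining variables. -/
theorem isGLB_sipObj (hy : y ∈ D.Y) (hp : ∀ l, 0 ≤ D.pHat y l)
    (hp_sum : ∑ l, D.pHat y l = 1) (hρ : 0 ≤ D.ρ) (hΞ : ∀ l, IsCompact (D.Ξ l))
    (hf : ∀ l, ContinuousOn D.f (D.Ξ l)) (hh : ∀ l, ContinuousOn (D.h y) (D.Ξ l))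
    {ψ : Fin L → ℝ} (hψ : ∀ l, IsGreatest (D.expCost y '' D.momentSet l y) (ψ l)) {v : ℝ}
    (hv : IsGreatest ((fun p => p ⬝ᵥ ψ) '' D.modeSet y) v) :
    IsGLB {t | ∃ z, D.SipFeasible z ∧ z.y = y ∧ t = D.sipObj z} (D.c ⬝ᵥ y + v) := by
  constructor
  · rintro _ ⟨z, hz, rfl, rfl⟩
    obtain ⟨p, hpm, hpv⟩ := hv.1
    have hψz : ∀ l, ψ l ≤ D.dualObj l z.y (z.α l) (z.βLow l) (z.βUp l) := by
      intro l
      obtain ⟨P, hP, hPψ⟩ := (hψ l).1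
      exact hPψ ▸ expCost_le_dualObj (hΞ l) (hf l) (hh l) hP (hz.dual l)
    have := dotProduct_le_of_mem_modeSet hp hpm hz.lam_nonneg
      (fun l => (sub_le_sub_right (hψz l) _).trans (hz.le_r l))
      (fun l => (sub_le_sub_right (hψz l) _).trans (hz.le_lam l)) hz.neg_lam_le
    rw [sipObj]
    simp only at hpv
    linarith
  · intro t ht
    refine le_of_forall_pos_le_add fun ε hε => ?_
    obtain ⟨lam, eta, r, hlam, hr, hl, hrl, hobj⟩ := exists_modeDual_le hp hp_sum hρ
      (fun p hpm => hv.2 ⟨p, hpm, rfl⟩) (half_pos hε)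
    choose α βLow βUp hdf hdo using fun l =>
      exists_dualFeasible_dualObj_le (hΞ l) (hf l) (hh l) (Set.image_nonempty.1 (hψ l).nonempty)
        (hψ l).2 (half_pos hε)
    -- Raising `eta` by `ε / 2` absorbs the excess of the near-optimal moment duals over `ψ`; the
    -- mode dual spends the other half.
    have hz : D.SipFeasible ⟨y, lam, eta + ε / 2, r, α, βLow, βUp⟩ :=
      { mem := hy
        lam_nonneg := hlam
        dual := hdf
        le_r := fun l => by
          have h1 := hdo l
          have h2 := hr l
          dsimp only
          linarith
        le_lam := fun l => by
          have h1 := hdo l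
          have h2 := hl l
          dsimp only
          linarith
        neg_lam_le := hrl }
    have := ht ⟨_, hz, rfl, rfl⟩
    simp only [sipObj] at this
    linarith

/-! ### Equivalence of the two models -/

section Equivalence

variable {w : (Fin I → ℝ) → ℝ}

/-- An infimum over all variables is an iterated infimum, first over the fibre of each `y`;
near-minimizers suffice, so fibres need not attain it. -/
theorem droValue_eq_sipValue (hw : ∀ y ∈ D.Y, D.droObj y = (w y : EReal))
    (hglb : ∀ y ∈ D.Y, IsGLB {t | ∃ z, D.SipFeasible z ∧ z.y = y ∧ t = D.sipObj z} (w y)) :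
    D.droValue = D.sipValue := by
  refine le_antisymm (le_iInf₂ fun z hz => ?_) (le_iInf₂ fun y hy => ?_)
  · refine (iInf₂_le z.y hz.mem).trans ?_
    rw [hw _ hz.mem]
    exact EReal.coe_le_coe_iff.2 ((hglb _ hz.mem).1 ⟨z, hz, rfl, rfl⟩)
  · rw [hw y hy]
    refine EReal.le_of_forall_lt_iff_le.1 fun t ht => ?_
    obtain ⟨_, ⟨z, hz, -, rfl⟩, -, hlt⟩ := (hglb y hy).exists_between (EReal.coe_lt_coe_iff.1 ht)
    exact (iInf₂_le z hz).trans (EReal.coe_le_coe_iff.2 hlt.le)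

/-- A feasible `z` never beats the fibre infimum `w z.y`, while an optimal one lies below every `w
y`; so it attains its fibre infimum and `z.y` minimizes `w`. Equality of objectives is required
because a fibre may contain non-optimal points. -/
theorem isSipOptimal_iff (hw : ∀ y ∈ D.Y, D.droObj y = (w y : EReal))
    (hglb : ∀ y ∈ D.Y, IsGLB {t | ∃ z, D.SipFeasible z ∧ z.y = y ∧ t = D.sipObj z} (w y))
    (z : SipVar I L M) :
    D.IsSipOptimal z ↔
      D.SipFeasible z ∧ D.IsDroOptimal z.y ∧ (D.sipObj z : EReal) = D.droObj z.y := by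
  constructor
  · rintro ⟨hz, hopt⟩
    have hle : ∀ y ∈ D.Y, D.sipObj z ≤ w y := fun y hy => (hglb y hy).2 (by
      rintro _ ⟨z', hz', -, rfl⟩
      exact hopt z' hz')
    have heq : D.sipObj z = w z.y :=
      le_antisymm (hle _ hz.mem) ((hglb _ hz.mem).1 ⟨z, hz, rfl, rfl⟩)
    refine ⟨hz, ⟨hz.mem, fun y hy => ?_⟩, ?_⟩
    · rw [hw _ hz.mem, hw y hy, ← heq]
      exact EReal.coe_le_coe_iff.2 (hle y hy)
    · rw [hw _ hz.mem, heq]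
  · rintro ⟨hz, ⟨hy, hopt⟩, heq⟩
    refine ⟨hz, fun z' hz' => ?_⟩
    have h1 := hopt z'.y hz'.mem
    rw [← heq, hw _ hz'.mem, EReal.coe_le_coe_iff] at h1
    exact h1.trans ((hglb _ hz'.mem).1 ⟨z', hz', rfl, rfl⟩)

end Equivalence

end Data

end MultimodalDRO

end

/-! ### Assembly of the fibrewise duality and the equivalence -/

theorem theorem4 {I J N S L M : ℕ} (D : MultimodalDRO.Data I J N S L M)
    -- the second-stage problem is feasible and has a finite value
    (hfeas : ∀ y ∈ D.Y, ∀ l, ∀ ξ ∈ D.Ξ l, (D.recourse y ξ).Nonempty)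
    (hfin : ∀ y ∈ D.Y, ∀ l, ∀ ξ ∈ D.Ξ l, BddBelow (D.recourseCosts y ξ))
    -- reference mode probabilities and robustness level
    (hp : ∀ y ∈ D.Y, ∀ l, 0 ≤ D.pHat y l)
    (hp_sum : ∀ y ∈ D.Y, ∑ l, D.pHat y l = 1)
    (hρ : 0 ≤ D.ρ)
    -- compact supports and continuous moment functions
    (hΞ : ∀ l, IsCompact (D.Ξ l))
    (hf : ∀ l, ContinuousOn D.f (D.Ξ l))
    -- nonemptiness, implied by a nonempty relative interior
    (hU : ∀ y ∈ D.Y, ∀ l, (D.momentSet l y).Nonempty) :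
    -- strong duality of the moment problem of each mode
    (∀ y ∈ D.Y, ∀ l, ∃ ψ : ℝ,
      IsGreatest (D.expCost y '' D.momentSet l y) ψ ∧
      IsGLB {t | ∃ α βLow βUp, D.DualFeasible l y α βLow βUp ∧
        t = D.dualObj l y α βLow βUp} ψ) ∧
    -- at each decision, the robust objective is the infimum over the remaining variables
    (∀ y ∈ D.Y,
      (∀ P ∈ D.ambiguity y, IsProbabilityMeasure P ∧ MeasureTheory.Integrable (D.h y) P) ∧
      ∃ v : ℝ, IsGreatest (D.expCost y '' D.ambiguity y) v ∧
        D.droObj y = ((D.c ⬝ᵥ y + v : ℝ) : EReal) ∧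
        IsGLB {t | ∃ z, D.SipFeasible z ∧ z.y = y ∧ t = D.sipObj z} (D.c ⬝ᵥ y + v)) ∧
    -- equal optimal values, and the correspondence of optimal solutions
    D.droValue = D.sipValue ∧
    (∀ z, D.IsSipOptimal z ↔
      D.SipFeasible z ∧ D.IsDroOptimal z.y ∧ (D.sipObj z : EReal) = D.droObj z.y) := by
  have hh : ∀ y ∈ D.Y, ∀ l, ContinuousOn (D.h y) (D.Ξ l) := fun y hy l =>
    D.continuousOn_h (hfeas y hy l) (hfin y hy l)
  have hψ : ∀ y ∈ D.Y, ∀ l, ∃ ψ : ℝ, IsGreatest (D.expCost y '' D.momentSet l y) ψ :=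
    fun y hy l => MultimodalDRO.Data.exists_isGreatest_expCost_momentSet (hΞ l) (hf l)
      (hh y hy l) (hU y hy l)
  have hdec : ∀ y ∈ D.Y, ∃ v : ℝ, IsGreatest (D.expCost y '' D.ambiguity y) v ∧
      D.droObj y = ((D.c ⬝ᵥ y + v : ℝ) : EReal) ∧
      IsGLB {t | ∃ z, D.SipFeasible z ∧ z.y = y ∧ t = D.sipObj z} (D.c ⬝ᵥ y + v) := by
    intro y hy
    choose ψ hψy using hψ y hy
    obtain ⟨v, hv, hvm⟩ := MultimodalDRO.Data.exists_isGreatest_expCost_ambiguity (hp y hy)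
      (hp_sum y hy) hρ hΞ (hh y hy) hψy
    exact ⟨v, hv, MultimodalDRO.Data.droObj_eq_coe hv, MultimodalDRO.Data.isGLB_sipObj hy (hp y hy)
      (hp_sum y hy) hρ hΞ hf (hh y hy) hψy hvm⟩
  obtain ⟨w, hw, hglb⟩ : ∃ w : (Fin I → ℝ) → ℝ, (∀ y ∈ D.Y, D.droObj y = (w y : EReal)) ∧
      ∀ y ∈ D.Y, IsGLB {t | ∃ z, D.SipFeasible z ∧ z.y = y ∧ t = D.sipObj z} (w y) := by
    choose! v _ hv hglb using hdec
    exact ⟨fun y => D.c ⬝ᵥ y + v y, hv, hglb⟩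
  refine ⟨fun y hy l => ?_, fun y hy => ⟨fun P hP => ?_, hdec y hy⟩,
    MultimodalDRO.Data.droValue_eq_sipValue hw hglb,
    MultimodalDRO.Data.isSipOptimal_iff hw hglb⟩
  · obtain ⟨ψ, hψy⟩ := hψ y hy l
    refine ⟨ψ, hψy, ?_, fun t ht => ?_⟩
    · rintro _ ⟨α, βLow, βUp, hd, rfl⟩
      obtain ⟨P, hP, rfl⟩ := hψy.1
      exact MultimodalDRO.Data.expCost_le_dualObj (hΞ l) (hf l) (hh y hy l) hP hd
    · refine le_of_forall_pos_le_add fun ε hε => ?_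
      obtain ⟨α, βLow, βUp, hd, hle⟩ := MultimodalDRO.Data.exists_dualFeasible_dualObj_le (hΞ l)
        (hf l) (hh y hy l) (hU y hy l) hψy.2 hε
      exact (ht ⟨α, βLow, βUp, hd, rfl⟩).trans hle
  · exact MultimodalDRO.Data.isProbabilityMeasure_and_integrable_of_mem_ambiguity hΞ (hh y hy) hP
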